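/- Let $A\in\mathbb C^{n\times n}$ and let $z_1,\dots,z_N\in\mathbb C$ ($N\ge1$) be arbitrary, possibly repeated, points. Let $f$ be an analytic function on an open set $U\subseteq\mathbb C$ (possibly disconnected) that contains the convex hull of $\sigma(A)\cup\{z_1,\dots,z_N\}$, where $\sigma(A)$ is the spectrum of $A$. Let $r=u/v$, where $u,v$ are complex polynomials, $\deg u\le N-1$, $v(z_k)\ne0$ for $k=1,\dots,N$, and $v(\lambda)\ne0$ for $\lambda\in\sigma(A)$. Suppose that $r$ interpolates $f$ at $z_1,\dots,z_N$ counted according to multiplicity: $r^{(j)}(z_k)=f^{(j)}(z_k)$ for $k=1,\dots,N$ and every $0\le j<n_k$, where $n_k$ is the number of repetitions of $z_k$ in the list $z_1,\dots,z_N$. Put $\Omega(z)=\prod_{k=1}^N(z-z_k)$. Then for any norm $\|\cdot\|$ on the complex linear space $\mathbb C^{n\times n}$ the maximum below is attained, and $$\|f(A)-r(A)\|\le\max_{\substack{t\in[0,1]\\ \mu\in\operatorname{co}\{z_1,\dots,z_N\}}}\Bigl\|\Omega(A)[v(A)]^{-1}\frac{(vf)^{(N)}\bigl((1-t)\mu\mathbf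 1+tA\bigr)}{N!}\Bigr\|.$$ Here $\operatorname{co}$ is the convex hull, $\mathbf 1$ is the identity matrix, and a function $g$ analytic in a neighbourhood of $\sigma(B)$ is applied to a matrix $B$ by $g(B)=\frac1{2\pi i}\int_\Gamma g(\lambda)(\lambda\mathbf 1-B)^{-1}\,d\lambda$, where the contour $\Gamma$ encloses $\sigma(B)$ and lies, with its interior, in the domain of $g$. -/

import Mathlib

open Filter Topology

namespace MatrixEstimate

/-- The Cauchy integral `(2πi)⁻¹ ∫_Γ f(z) (z𝟏 - A)⁻¹ dz` (computed entrywise), where the contour `Γ`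
consists of the positively oriented circles of radius `ε` centred at the eigenvalues of `A`. -/
noncomputable def cauchyIntegral {n : ℕ} (f : ℂ → ℂ) (A : Matrix (Fin n) (Fin n) ℂ) (ε : ℝ) :
    Matrix (Fin n) (Fin n) ℂ :=
  ∑ w ∈ A.finite_spectrum.toFinset,
    Matrix.of fun i j =>
      (2 * Real.pi * Complex.I : ℂ)⁻¹ *
        ∮ z in C(w, ε), f z * (z • (1 : Matrix (Fin n) (Fin n) ℂ) - A)⁻¹ i j

/-- The function `f`, analytic at the points of the spectrum of `A`, applied to the matrix `A`:
the Cauchy integral of `f` against the resolvent of `A` over a contour that encloses the spectrum.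
The contour consists of small circles around the eigenvalues; for all sufficiently small radii the
integral has the same value, see `eventually_cauchyIntegral_eq_matrixFun`. -/
noncomputable def matrixFun {n : ℕ} (f : ℂ → ℂ) (A : Matrix (Fin n) (Fin n) ℂ) :
    Matrix (Fin n) (Fin n) ℂ :=
  limUnder (𝓝[>] (0 : ℝ)) (cauchyIntegral f A)

theorem differentiableAt_integrand {n : ℕ} {f : ℂ → ℂ} {A : Matrix (Fin n) (Fin n) ℂ} {z : ℂ}
    (hf : AnalyticAt ℂ f z) (hz : z ∉ spectrum ℂ A) (i j : Fin n) :
    DifferentiableAt ℂ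
      (fun z => f z * (z • (1 : Matrix (Fin n) (Fin n) ℂ) - A)⁻¹ i j) z := by
  have hu : IsUnit (z • (1 : Matrix (Fin n) (Fin n) ℂ) - A) := by
    simpa [spectrum.mem_iff, Algebra.algebraMap_eq_smul_one] using hz
  have hd : (z • (1 : Matrix (Fin n) (Fin n) ℂ) - A).det ≠ 0 :=
    ((Matrix.isUnit_iff_isUnit_det _).1 hu).ne_zero
  have hent : ∀ k l, Differentiable ℂ
      (fun z : ℂ => (z • (1 : Matrix (Fin n) (Fin n) ℂ) - A) k l) := by
    intro k l
    simp only [Matrix.sub_apply, Matrix.smul_apply, smul_eq_mul]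
    fun_prop
  have hdet : ∀ M : ℂ → Matrix (Fin n) (Fin n) ℂ, (∀ k l, Differentiable ℂ fun z => M z k l) →
      Differentiable ℂ (fun z => (M z).det) := by
    intro M hM
    simp only [Matrix.det_apply]
    refine Differentiable.fun_sum fun σ _ => ?_
    refine Differentiable.const_smul ?_ _
    exact Differentiable.fun_finsetProd fun k _ => hM _ _
  refine hf.differentiableAt.mul ?_
  simp only [Matrix.inv_def, Matrix.smul_apply, Ring.inverse_eq_inv', smul_eq_mul,
    Matrix.adjugate_apply]
  refine ((hdet _ hent) z).inv hd |>.mul ?_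
  refine (hdet _ fun k l => ?_) z
  by_cases h : k = j
  · subst h
    simp
  · simpa [Matrix.updateRow_ne h] using hent k l

/-- The value of the Cauchy integral does not depend on the (small) radius of the circles. -/
theorem eventually_cauchyIntegral_eq_matrixFun {n : ℕ} {f : ℂ → ℂ}
    {A : Matrix (Fin n) (Fin n) ℂ} (hf : AnalyticOnNhd ℂ f (spectrum ℂ A)) :
    ∀ᶠ ε in 𝓝[>] (0 : ℝ), cauchyIntegral f A ε = matrixFun f A := by
  have key : ∀ w ∈ A.finite_spectrum.toFinset, ∃ δ > 0, ∀ z, dist z w < δ → z ≠ w →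
      AnalyticAt ℂ f z ∧ z ∉ spectrum ℂ A := by
    intro w hw
    have h1 := (hf w (by simpa using hw)).eventually_analyticAt
    have h2 : ∀ᶠ z in 𝓝 w, z ∉ spectrum ℂ A \ {w} :=
      (A.finite_spectrum.subset Set.sdiff_subset).isClosed.isOpen_compl.mem_nhds (by simp)
    obtain ⟨δ, hδ, h⟩ := Metric.eventually_nhds_iff.1 (h1.and h2)
    exact ⟨δ, hδ, fun z hz hne => ⟨(h hz).1, fun hs => (h hz).2 ⟨hs, hne⟩⟩⟩
  have hδ : ∃ δ > 0, ∀ w ∈ A.finite_spectrum.toFinset, ∀ z, dist z w < δ → z ≠ w →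
      AnalyticAt ℂ f z ∧ z ∉ spectrum ℂ A := by
    have : ∀ᶠ δ in 𝓝[>] (0 : ℝ), ∀ w ∈ A.finite_spectrum.toFinset, ∀ z, dist z w < δ → z ≠ w →
        AnalyticAt ℂ f z ∧ z ∉ spectrum ℂ A := by
      rw [Filter.eventually_all_finset]
      intro w hw
      obtain ⟨δ, hδ, h⟩ := key w hw
      filter_upwards [Ioo_mem_nhdsGT hδ] with ε hε z hz hne
      exact h z (hz.trans hε.2) hne
    obtain ⟨δ, h, h'⟩ := (this.and self_mem_nhdsWithin).exists
    exact ⟨δ, h', h⟩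
  obtain ⟨δ, hδ, h⟩ := hδ
  have hle : ∀ r R : ℝ, 0 < r → r ≤ R → R < δ → cauchyIntegral f A R = cauchyIntegral f A r := by
    intro r R hr hrR hR
    refine Finset.sum_congr rfl fun w hw => ?_
    ext i j
    simp only [Matrix.of_apply]
    congr 1
    have hd : ∀ z ∈ Metric.closedBall w R \ Metric.ball w r, DifferentiableAt ℂ
        (fun z => f z * (z • (1 : Matrix (Fin n) (Fin n) ℂ) - A)⁻¹ i j) z := by
      rintro z ⟨hz1, hz2⟩
      have hne : z ≠ w := by
        rintro rfl
        exact hz2 (Metric.mem_ball_self hr)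
      obtain ⟨ha, hs⟩ := h w hw z (lt_of_le_of_lt (Metric.mem_closedBall.1 hz1) hR) hne
      exact differentiableAt_integrand ha hs i j
    refine Complex.circleIntegral_eq_of_differentiable_on_annulus_off_countable hr hrR
      Set.countable_empty (fun z hz => (hd z hz).continuousAt.continuousWithinAt) ?_
    rintro z ⟨⟨hz1, hz2⟩, -⟩
    exact hd z ⟨Metric.ball_subset_closedBall hz1,
      fun hb => hz2 (Metric.ball_subset_closedBall hb)⟩
  have hconst : ∀ ε ∈ Set.Ioo 0 δ, cauchyIntegral f A ε = cauchyIntegral f A (δ / 2) := by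
    rintro ε ⟨h1, h2⟩
    rcases le_total ε (δ / 2) with h3 | h3
    · exact (hle _ _ h1 h3 (by linarith)).symm
    · exact hle _ _ (by linarith) h3 h2
  have hev : ∀ᶠ ε in 𝓝[>] (0 : ℝ), cauchyIntegral f A ε = cauchyIntegral f A (δ / 2) := by
    filter_upwards [Ioo_mem_nhdsGT hδ] with ε hε using hconst ε hε
  have hlim : matrixFun f A = cauchyIntegral f A (δ / 2) :=
    (tendsto_const_nhds.congr' (hev.mono fun _ h => h.symm)).limUnder_eq
  rw [hlim]
  exact hev

/-- The multiplicity of the point `z k` in the list `z`: the number of its repetitions. -/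
noncomputable def nodeMultiplicity {N : ℕ} (z : Fin N → ℂ) (k : Fin N) : ℕ :=
  Nat.card {i : Fin N // z i = z k}

/-- `r` interpolates `f` at the points `z k`, counted according to their multiplicities. -/
def Interpolates {N : ℕ} (z : Fin N → ℂ) (r f : ℂ → ℂ) : Prop :=
  ∀ k : Fin N, ∀ j < nodeMultiplicity z k, iteratedDeriv j r (z k) = iteratedDeriv j f (z k)

/-- The polynomial `Ω(x) = ∏ (x - z k)`. -/
noncomputable def nodePoly {N : ℕ} (z : Fin N → ℂ) : Polynomial ℂ :=
  ∏ k : Fin N, (Polynomial.X - Polynomial.C (z k))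

/-- The matrix `Ω(A) v(A)⁻¹ (v f)^(N)((1 - t) μ 𝟏 + t A) / N!`. -/
noncomputable def remainderMatrix {n N : ℕ} (A : Matrix (Fin n) (Fin n) ℂ) (z : Fin N → ℂ)
    (v : Polynomial ℂ) (f : ℂ → ℂ) (t : ℝ) (μ : ℂ) : Matrix (Fin n) (Fin n) ℂ :=
  Polynomial.aeval A (nodePoly z) * (Polynomial.aeval A v)⁻¹ *
    ((N.factorial : ℂ)⁻¹ •
      matrixFun (iteratedDeriv N fun x => v.eval x * f x)
        (((1 - (t : ℂ)) * μ) • (1 : Matrix (Fin n) (Fin n) ℂ) + (t : ℂ) • A))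

end MatrixEstimate

namespace MatrixEstimate

/-! The function `q = v f - u` vanishes at the nodes to their multiplicities, so `q = Ω h` with `h`
analytic on `U`. Hence `f - r = Ω h / v` near the spectrum and `f(A) - r(A) = L h(A)` with `L = Ω(A)
v(A)⁻¹` (`matrixFun_sub_eq`). Since `deg u < N`, the `N`-th derivatives of `q` and `v f` agree. What
remains is to bound `L h(A)` by `L q^(N)(B) / N!` over the family `B = (1 - t) μ 𝟏 + t A`.

The nodes are divided out one at a time. If `D(x) = (g(x) - g(a)) / (x - a)`, then `D^(k)(x) = ∫₀¹
s^k g^(k+1)(a + s (x - a)) ds`. Contraction towards a node `a` maps the family of the `B` into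
itself (`exists_mem_convex_eq`), so a bound `(k+1)! m` for `L g^(k+1)` on the family gives `k! m`
for `L D^(k)` (`norm_jetSum_dslope_le`). After all nodes the bound for `L h` is `m`, and `t = 1`
gives `B = A`.

Matrices enter only through `jetSum`: on generalized eigenspaces of `A`, `g(B)` is a finite
combination of derivatives of `g` at the points `(1 - t) μ + t w` (`matrixFun_smul_one_add_smul`).
-/

/-! ### Iterated derivatives and divided differences. -/

theorem iteratedDeriv_iteratedDeriv (j k : ℕ) (h : ℂ → ℂ) :
    iteratedDeriv j (iteratedDeriv k h) = iteratedDeriv (j + k) h := by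
  simp only [iteratedDeriv_eq_iterate, Function.iterate_add_apply]

theorem analyticAt_iteratedDeriv {h : ℂ → ℂ} {x : ℂ} (hh : AnalyticAt ℂ h x) (k : ℕ) :
    AnalyticAt ℂ (iteratedDeriv k h) x := by
  rw [iteratedDeriv_eq_iterate]
  exact hh.iterated_deriv k

theorem hasDerivAt_iteratedDeriv {h : ℂ → ℂ} {x : ℂ} (hh : AnalyticAt ℂ h x) (k : ℕ) :
    HasDerivAt (iteratedDeriv k h) (iteratedDeriv (k + 1) h x) x := by
  rw [iteratedDeriv_succ]
  exact (analyticAt_iteratedDeriv hh k).differentiableAt.hasDerivAt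

/-- The Leibniz rule for a linear factor. -/
theorem iteratedDeriv_succ_sub_mul {h : ℂ → ℂ} (a : ℂ) (k : ℕ) {x : ℂ} (hh : AnalyticAt ℂ h x) :
    iteratedDeriv (k + 1) (fun y => (y - a) * h y) x =
      (x - a) * iteratedDeriv (k + 1) h x + (k + 1) * iteratedDeriv k h x := by
  induction k generalizing x with
  | zero =>
    have := ((hasDerivAt_id x).sub_const a).mul (hasDerivAt_iteratedDeriv hh 0)
    simp only [zero_add, iteratedDeriv_one, iteratedDeriv_zero] at this ⊢
    refine this.deriv.trans ?_
    simp
    ring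
  | succ k ih =>
    have hev : iteratedDeriv (k + 1) (fun y => (y - a) * h y) =ᶠ[𝓝 x]
        fun y => (y - a) * iteratedDeriv (k + 1) h y + (k + 1) * iteratedDeriv k h y := by
      filter_upwards [hh.eventually_analyticAt] with y hy using ih hy
    have hd := (((hasDerivAt_id x).sub_const a).mul (hasDerivAt_iteratedDeriv hh (k + 1))).add
      ((hasDerivAt_iteratedDeriv hh k).const_mul ((k : ℂ) + 1))
    rw [iteratedDeriv_succ, hev.deriv_eq]
    refine hd.deriv.trans ?_
    simp
    ring

theorem eq_add_sub_mul_dslope (h : ℂ → ℂ) (a x : ℂ) : h x = h a + (x - a) * dslope h a x := by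
  have := sub_smul_dslope h a x
  rw [smul_eq_mul] at this
  rw [this]
  ring

theorem analyticOnNhd_dslope {h : ℂ → ℂ} {U : Set ℂ} (hU : IsOpen U) (hh : AnalyticOnNhd ℂ h U)
    {a : ℂ} (ha : a ∈ U) : AnalyticOnNhd ℂ (dslope h a) U :=
  ((Complex.differentiableOn_dslope (hU.mem_nhds ha)).2 hh.differentiableOn).analyticOnNhd hU

theorem iteratedDeriv_succ_eq_dslope {h : ℂ → ℂ} {U : Set ℂ} (hU : IsOpen U)
    (hh : AnalyticOnNhd ℂ h U) {a x : ℂ} (ha : a ∈ U) (hx : x ∈ U) (k : ℕ) :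
    iteratedDeriv (k + 1) h x = (x - a) * iteratedDeriv (k + 1) (dslope h a) x +
      (k + 1) * iteratedDeriv k (dslope h a) x := by
  rw [← iteratedDeriv_succ_sub_mul a k (analyticOnNhd_dslope hU hh ha x hx)]
  have : h = fun y => h a + (y - a) * dslope h a y := funext fun y => eq_add_sub_mul_dslope h a y
  conv_lhs => rw [this]
  rw [iteratedDeriv_succ', iteratedDeriv_succ']
  simp

/-! ### Jet sums and division by linear factors. -/

/-- The value of `h` at the point `(1 - t) μ + t A`, where `A` is given by spectral data: the
eigenvalues `W` and the coefficients `X w j` of the `j`-th derivative at `w`. -/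
noncomputable def jetSum {V : Type*} [AddCommGroup V] [Module ℂ V] (W : Finset ℂ) (n : ℕ)
    (X : ℂ → ℕ → V) (h : ℂ → ℂ) (t : ℝ) (μ : ℂ) : V :=
  ∑ w ∈ W, ∑ j ∈ Finset.range n,
    ((t : ℂ) ^ j * iteratedDeriv j h ((1 - t) * μ + t * w)) • X w j

/-- The terms free of `w` are `(1 - s) a + s (1 - t) μ`, of total weight `1 - s t`; normalizing
gives `μ'`. It does not depend on `w`, so all eigenvalues move together. The condition `s < 1` keeps
the weight nonzero even at `t = 1`. -/
theorem exists_mem_convex_eq {S : Set ℂ} (hS : Convex ℝ S) {a μ : ℂ} (ha : a ∈ S) (hμ : μ ∈ S)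
    {s t : ℝ} (hs0 : 0 ≤ s) (hs1 : s < 1) (ht1 : t ≤ 1) :
    ∃ μ' ∈ S, ∀ w : ℂ, a + s * ((1 - t) * μ + t * w - a) =
      (1 - ((s * t : ℝ) : ℂ)) * μ' + ((s * t : ℝ) : ℂ) * w := by
  have hst : s * t < 1 := by nlinarith
  have hne : (1 - s * t) ≠ 0 := by linarith
  have hneC : (1 - s * t : ℂ) ≠ 0 := by exact_mod_cast hne
  refine ⟨((1 - s) / (1 - s * t)) • a + (s * (1 - t) / (1 - s * t)) • μ,
    hS ha hμ (div_nonneg (by linarith) (by linarith))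
      (div_nonneg (mul_nonneg hs0 (by linarith)) (by linarith)) ?_, fun w => ?_⟩
  · field_simp
    ring
  · simp only [Complex.real_smul]
    push_cast
    field_simp
    ring

/-- The integral formula for derivatives of a divided difference, in the form of a mean value
inequality, so that no vector-valued integral is needed. -/
theorem norm_jetSum_dslope_le {V : Type*} [NormedAddCommGroup V] [NormedSpace ℂ V]
    {W : Finset ℂ} {n : ℕ} {X : ℂ → ℕ → V} {U S : Set ℂ} (hU : IsOpen U) (hS : Convex ℝ S)
    (hSU : S ⊆ U)
    (hWU : ∀ w ∈ W, ∀ t ∈ Set.Icc (0 : ℝ) 1, ∀ μ ∈ S, (1 - (t : ℂ)) * μ + t * w ∈ U)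
    {h : ℂ → ℂ} (hh : AnalyticOnNhd ℂ h U) {a : ℂ} (ha : a ∈ S) {k : ℕ} {m : ℝ}
    (H : ∀ t ∈ Set.Icc (0 : ℝ) 1, ∀ μ ∈ S,
      ‖jetSum W n X (iteratedDeriv (k + 1) h) t μ‖ ≤ (k + 1).factorial * m)
    {t : ℝ} (ht : t ∈ Set.Icc (0 : ℝ) 1) {μ : ℂ} (hμ : μ ∈ S) :
    ‖jetSum W n X (iteratedDeriv k (dslope h a)) t μ‖ ≤ k.factorial * m := by
  set D := dslope h a with hD
  have hDa : AnalyticOnNhd ℂ D U := analyticOnNhd_dslope hU hh (hSU ha)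
  set b : ℂ → ℂ := fun w => (1 - (t : ℂ)) * μ + t * w with hb
  have hseg : ∀ w ∈ W, ∀ s ∈ Set.Icc (0 : ℝ) 1, a + s * (b w - a) ∈ U := by
    intro w hw s hs
    rcases hs.2.lt_or_eq with h1 | h1
    · obtain ⟨μ', hμ', he⟩ := exists_mem_convex_eq hS ha hμ hs.1 h1 ht.2
      rw [hb, he w]
      exact hWU w hw _ ⟨mul_nonneg hs.1 ht.1, mul_le_one₀ hs.2 ht.1 ht.2⟩ _ hμ'
    · rw [h1]
      simpa using hWU w hw t ht μ hμ
  -- `Ψ s` is `s^(k+1)` times the jet sum of `D^(k)` contracted towards `a` by `s`; it vanishes at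
  -- `0` and is the wanted value at `1`.
  let Ψ : ℝ → V := fun s => ∑ w ∈ W, ∑ j ∈ Finset.range n,
    ((t : ℂ) ^ j * ((s : ℂ) ^ (j + k + 1) * iteratedDeriv (j + k) D (a + s * (b w - a)))) • X w j
  let Ψ' : ℝ → V := fun s => ∑ w ∈ W, ∑ j ∈ Finset.range n,
    ((t : ℂ) ^ j * ((s : ℂ) ^ (j + k) * iteratedDeriv (j + k + 1) h (a + s * (b w - a)))) • X w j
  have hder : ∀ s ∈ Set.Icc (0 : ℝ) 1, HasDerivAt Ψ (Ψ' s) s := by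
    intro s hs
    refine HasDerivAt.fun_sum fun w hw => HasDerivAt.fun_sum fun j _ => ?_
    refine HasDerivAt.smul_const (HasDerivAt.const_mul _ ?_) _
    have hγ := hseg w hw s hs
    have hl : HasDerivAt (fun z : ℂ => a + z * (b w - a)) (b w - a) (s : ℂ) := by
      simpa using ((hasDerivAt_id (s : ℂ)).mul_const (b w - a)).const_add a
    have h1 := (hasDerivAt_iteratedDeriv (hDa _ hγ) (j + k)).comp (s : ℂ) hl
    have h2 := ((hasDerivAt_pow (j + k + 1) (s : ℂ)).mul h1).comp_ofReal
    refine h2.congr_deriv ?_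
    rw [iteratedDeriv_succ_eq_dslope hU hh (hSU ha) hγ]
    simp only [Function.comp_apply, Nat.add_sub_cancel]
    push_cast
    ring
  have hΨ' : ∀ s ∈ Set.Ico (0 : ℝ) 1, ‖Ψ' s‖ ≤ (k + 1 : ℕ) * s ^ k * (k.factorial * m) := by
    intro s hs
    obtain ⟨μ', hμ', he⟩ := exists_mem_convex_eq hS ha hμ hs.1 hs.2 ht.2
    -- The factor `s^j` joins `t^j`, which turns the parameter `t` into `s t`.
    have : Ψ' s = ((s : ℂ) ^ k) • jetSum W n X (iteratedDeriv (k + 1) h) (s * t) μ' := by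
      simp only [Ψ', jetSum, Finset.smul_sum, iteratedDeriv_iteratedDeriv, smul_smul]
      refine Finset.sum_congr rfl fun w _ => Finset.sum_congr rfl fun j _ => ?_
      rw [hb, he w]
      push_cast
      congr 1
      rw [← add_assoc]
      ring
    rw [this, norm_smul, norm_pow, Complex.norm_real, Real.norm_of_nonneg hs.1]
    have := H (s * t) ⟨mul_nonneg hs.1 ht.1, mul_le_one₀ hs.2.le ht.1 ht.2⟩ μ' hμ'
    calc s ^ k * _ ≤ s ^ k * ((k + 1).factorial * m) :=
          mul_le_mul_of_nonneg_left this (pow_nonneg hs.1 k)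
      _ = _ := by
        rw [Nat.factorial_succ]
        push_cast
        ring
  have key := image_norm_le_of_norm_deriv_right_le_deriv_boundary (f := Ψ) (f' := Ψ')
    (a := 0) (b := 1) (B := fun s => s ^ (k + 1) * (k.factorial * m))
    (B' := fun s => (k + 1 : ℕ) * s ^ k * (k.factorial * m))
    (fun s hs => (hder s hs).continuousAt.continuousWithinAt)
    (fun s hs => (hder s ⟨hs.1, hs.2.le⟩).hasDerivWithinAt) (by simp [Ψ])
    (fun s => by simpa using (hasDerivAt_pow (k + 1) s).mul_const _) hΨ'
    (Set.right_mem_Icc.2 zero_le_one)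
  simpa [Ψ, jetSum, iteratedDeriv_iteratedDeriv] using key

/-- The quotient of an analytic function by a product of linear factors over its zeros, with the
estimate of its derivatives by those of the function. -/
theorem exists_quotient_with_bound {V : Type*} [NormedAddCommGroup V] [NormedSpace ℂ V]
    {W : Finset ℂ} {n : ℕ} {X : ℂ → ℕ → V} {U S : Set ℂ} (hU : IsOpen U) (hS : Convex ℝ S)
    (hSU : S ⊆ U)
    (hWU : ∀ w ∈ W, ∀ t ∈ Set.Icc (0 : ℝ) 1, ∀ μ ∈ S, (1 - (t : ℂ)) * μ + t * w ∈ U)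
    (l : List ℂ) (hl : ∀ a ∈ l, a ∈ S) {q : ℂ → ℂ} (hq : AnalyticOnNhd ℂ q U)
    (hord : ∀ a ∈ l, (l.count a : ℕ∞) ≤ analyticOrderAt q a) :
    ∃ h : ℂ → ℂ, AnalyticOnNhd ℂ h U ∧ (∀ x, q x = (l.map fun a => x - a).prod * h x) ∧
      ∀ (k : ℕ) (m : ℝ), (∀ t ∈ Set.Icc (0 : ℝ) 1, ∀ μ ∈ S,
        ‖jetSum W n X (iteratedDeriv (k + l.length) q) t μ‖ ≤ (k + l.length).factorial * m) →
        ∀ t ∈ Set.Icc (0 : ℝ) 1, ∀ μ ∈ S,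
          ‖jetSum W n X (iteratedDeriv k h) t μ‖ ≤ k.factorial * m := by
  induction l generalizing q with
  | nil => exact ⟨q, hq, by simp, fun k m H => by simpa using H⟩
  | cons a l ih =>
    have haS : a ∈ S := hl a (by simp)
    have hqa : q a = 0 := by
      apply apply_eq_zero_of_analyticOrderAt_ne_zero
      intro h0
      have := hord a (by simp)
      rw [h0] at this
      simp at this
    have hfac : q = (fun x => x - a) * dslope q a := by
      funext x
      simpa [hqa] using eq_add_sub_mul_dslope q a x
    have hD := analyticOnNhd_dslope hU hq (hSU haS)
    -- Dividing by `x - a` lowers the order by one at `a` and leaves it unchanged at other nodes,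
    -- just as `List.count` does.
    obtain ⟨h, hh, hprod, hbd⟩ := ih (fun b hb => hl b (by simp [hb])) hD (by
      intro b hb
      have h1 := hord b (by simp [hb])
      rw [hfac, analyticOrderAt_mul (by fun_prop) (hD b (hSU (hl b (by simp [hb]))))] at h1
      by_cases hab : a = b
      · subst hab
        have h2 : analyticOrderAt (fun x : ℂ => x - a) a = 1 := analyticOrderAt_id_sub_const_self
        rw [h2] at h1
        rw [List.count_cons_self, add_comm] at h1
        push_cast at h1
        exact (ENat.add_le_add_iff_left (by simp)).1 h1
      · have h2 : analyticOrderAt (fun x : ℂ => x - a) b = 0 :=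
          analyticOrderAt_id_sub_const_of_ne (Ne.symm hab)
        rwa [h2, zero_add, List.count_cons_of_ne hab] at h1)
    refine ⟨h, hh, fun x => ?_, fun k m H => hbd k m fun t ht μ hμ => ?_⟩
    · rw [eq_add_sub_mul_dslope q a x, hqa, hprod]
      simp [mul_assoc]
    · exact norm_jetSum_dslope_le hU hS hSU hWU hq haS H ht hμ

/-! ### Matrix functions on generalized eigenspaces. -/

variable {n : ℕ}

theorem isUnit_smul_one_sub {A : Matrix (Fin n) (Fin n) ℂ} {z : ℂ} (hz : z ∉ spectrum ℂ A) :
    IsUnit (z • (1 : Matrix (Fin n) (Fin n) ℂ) - A) := by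
  simpa [spectrum.mem_iff, Algebra.algebraMap_eq_smul_one] using hz

/-- The resolvent on a generalized eigenspace. -/
theorem inv_mul_eq_sum {A X : Matrix (Fin n) (Fin n) ℂ} {w z : ℂ} {k : ℕ}
    (hX : (A - w • 1) ^ k * X = 0) (hw : w ∈ spectrum ℂ A) (hz : z ∉ spectrum ℂ A) :
    (z • (1 : Matrix (Fin n) (Fin n) ℂ) - A)⁻¹ * X =
      ∑ j ∈ Finset.range k, (1 / (z - w) ^ (j + 1)) • ((A - w • 1) ^ j * X) := by
  have hzw : z - w ≠ 0 := fun h => hz (sub_eq_zero.1 h ▸ hw)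
  have hdet := (Matrix.isUnit_iff_isUnit_det _).1 (isUnit_smul_one_sub hz)
  set M := A - w • (1 : Matrix (Fin n) (Fin n) ℂ) with hM
  have hsplit : z • (1 : Matrix (Fin n) (Fin n) ℂ) - A = (z - w) • 1 - M := by
    rw [hM, sub_smul]
    abel
  have hmul : (z • (1 : Matrix (Fin n) (Fin n) ℂ) - A) *
      ∑ j ∈ Finset.range k, (1 / (z - w) ^ (j + 1)) • (M ^ j * X) = X := by
    -- The finite Neumann series telescopes.
    have hterm : ∀ j, (z • (1 : Matrix (Fin n) (Fin n) ℂ) - A) *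
        ((1 / (z - w) ^ (j + 1)) • (M ^ j * X)) =
        (1 / (z - w) ^ j) • (M ^ j * X) - (1 / (z - w) ^ (j + 1)) • (M ^ (j + 1) * X) := by
      intro j
      rw [hsplit, sub_mul, smul_mul_assoc, one_mul, smul_smul, mul_smul_comm, ← mul_assoc,
        ← pow_succ']
      congr 2
      field_simp
      rw [pow_succ']
    rw [Finset.mul_sum, Finset.sum_congr rfl fun j _ => hterm j, Finset.sum_range_sub', hX]
    simp
  conv_lhs => rw [← hmul]
  rw [← mul_assoc, Matrix.nonsing_inv_mul _ hdet, one_mul]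

theorem exists_radius {f : ℂ → ℂ} {A : Matrix (Fin n) (Fin n) ℂ}
    (hf : AnalyticOnNhd ℂ f (spectrum ℂ A)) :
    ∃ ε > 0, cauchyIntegral f A ε = matrixFun f A ∧ ∀ w ∈ spectrum ℂ A,
      ∀ z ∈ Metric.closedBall w ε, AnalyticAt ℂ f z ∧ (z ∈ spectrum ℂ A → z = w) := by
  have h2 : ∀ᶠ ε in 𝓝[>] (0 : ℝ), ∀ w ∈ A.finite_spectrum.toFinset,
      ∀ z ∈ Metric.closedBall w ε, AnalyticAt ℂ f z ∧ (z ∈ spectrum ℂ A → z = w) := by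
    rw [Filter.eventually_all_finset]
    intro w hw
    have h1 := (hf w (by simpa using hw)).eventually_analyticAt
    have h2 : ∀ᶠ z in 𝓝 w, z ∉ spectrum ℂ A \ {w} :=
      (A.finite_spectrum.subset Set.sdiff_subset).isClosed.isOpen_compl.mem_nhds (by simp)
    obtain ⟨δ, hδ, h⟩ := Metric.eventually_nhds_iff.1 (h1.and h2)
    filter_upwards [Ioo_mem_nhdsGT hδ] with ε hε z hz
    have := h (lt_of_le_of_lt (Metric.mem_closedBall.1 hz) hε.2)
    exact ⟨this.1, fun hs => by_contra fun hne => this.2 ⟨hs, hne⟩⟩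
  obtain ⟨ε, ⟨h1, h2⟩, h3⟩ :=
    ((eventually_cauchyIntegral_eq_matrixFun hf).and h2 |>.and self_mem_nhdsWithin).exists
  exact ⟨ε, h3, h1, fun w hw => h2 w (by simpa using hw)⟩

/-- A function of a matrix on a generalized eigenspace is given by the Taylor polynomial. -/
theorem matrixFun_mul_eq_sum {f : ℂ → ℂ} {A X : Matrix (Fin n) (Fin n) ℂ}
    (hf : AnalyticOnNhd ℂ f (spectrum ℂ A)) {w : ℂ} (hw : w ∈ spectrum ℂ A) {k : ℕ}
    (hX : (A - w • 1) ^ k * X = 0) :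
    matrixFun f A * X = ∑ j ∈ Finset.range k,
      ((j.factorial : ℂ)⁻¹ * iteratedDeriv j f w) • ((A - w • 1) ^ j * X) := by
  obtain ⟨ε, hε, hcau, hball⟩ := exists_radius hf
  have hns : ∀ w' ∈ spectrum ℂ A, ∀ z ∈ Metric.sphere w' ε, z ∉ spectrum ℂ A := by
    intro w' hw' z hz hzs
    rw [(hball w' hw' z (Metric.sphere_subset_closedBall hz)).2 hzs] at hz
    simp [hε.ne] at hz
  have hcont : ∀ w' ∈ spectrum ℂ A, ContinuousOn f (Metric.sphere w' ε) := fun w' hw' z hz =>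
    (hball w' hw' z (Metric.sphere_subset_closedBall hz)).1.continuousAt.continuousWithinAt
  have hentry : ∀ w' ∈ spectrum ℂ A, ∀ i m : Fin n,
      ((Matrix.of fun i j => (2 * Real.pi * Complex.I : ℂ)⁻¹ *
        ∮ z in C(w', ε), f z * (z • (1 : Matrix (Fin n) (Fin n) ℂ) - A)⁻¹ i j) * X) i m =
      ∑ j ∈ Finset.range k, ((A - w • 1) ^ j * X) i m * ((2 * Real.pi * Complex.I : ℂ)⁻¹ *
        ∮ z in C(w', ε), (1 / (z - w) ^ (j + 1)) • f z) := by
    intro w' hw' i m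
    have h1 : ∑ l, ∮ z in C(w', ε),
        X l m * (f z * (z • (1 : Matrix (Fin n) (Fin n) ℂ) - A)⁻¹ i l) =
        ∑ j ∈ Finset.range k, ∮ z in C(w', ε),
          ((A - w • 1) ^ j * X) i m * ((1 / (z - w) ^ (j + 1)) • f z) := by
      rw [← circleIntegral.integral_fun_sum, ← circleIntegral.integral_fun_sum]
      · refine circleIntegral.integral_congr hε.le fun z hz => ?_
        have h2 := congrFun (congrFun (inv_mul_eq_sum hX hw (hns w' hw' z hz)) i) m
        simp only [Matrix.mul_apply (N := X), Matrix.sum_apply, Matrix.smul_apply,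
          smul_eq_mul] at h2 ⊢
        calc _ = f z * ∑ l, (z • (1 : Matrix (Fin n) (Fin n) ℂ) - A)⁻¹ i l * X l m := by
              rw [Finset.mul_sum]
              exact Finset.sum_congr rfl fun l _ => by ring
          _ = _ := by
              rw [h2, Finset.mul_sum]
              exact Finset.sum_congr rfl fun l _ => by ring
      · intro j _
        refine ContinuousOn.circleIntegrable hε.le ?_
        refine continuousOn_const.mul (ContinuousOn.fun_smul (fun z hz => ?_) (hcont w' hw'))
        have hzw : z - w ≠ 0 := fun h => hns w' hw' z hz (sub_eq_zero.1 h ▸ hw)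
        have : ContinuousAt (fun z : ℂ => 1 / (z - w) ^ (j + 1)) z :=
          continuousAt_const.div (by fun_prop) (pow_ne_zero _ hzw)
        exact this.continuousWithinAt
      · intro l _
        refine ContinuousOn.circleIntegrable hε.le (continuousOn_const.mul fun z hz => ?_)
        exact (differentiableAt_integrand
          (hball w' hw' z (Metric.sphere_subset_closedBall hz)).1
          (hns w' hw' z hz) i l).continuousAt.continuousWithinAt
    simp only [circleIntegral.integral_const_mul] at h1
    rw [Matrix.mul_apply]
    simp only [Matrix.of_apply]
    calc _ = (2 * Real.pi * Complex.I : ℂ)⁻¹ * ∑ l, X l m * ∮ z in C(w', ε),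
          f z * (z • (1 : Matrix (Fin n) (Fin n) ℂ) - A)⁻¹ i l := by
          rw [Finset.mul_sum]
          exact Finset.sum_congr rfl fun l _ => by ring
      _ = _ := by
          rw [h1, Finset.mul_sum]
          exact Finset.sum_congr rfl fun l _ => by ring
  -- After multiplication by `X` the only pole left is `w`: its circle yields Taylor coefficients,
  -- the other circles contribute zero.
  rw [← hcau, cauchyIntegral, Finset.sum_mul, Finset.sum_eq_single w]
  · ext i m
    rw [hentry w hw, Matrix.sum_apply]
    refine Finset.sum_congr rfl fun j _ => ?_
    have hd : DifferentiableOn ℂ f (Metric.closedBall w ε) := fun z hz =>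
      (hball w hw z hz).1.differentiableAt.differentiableWithinAt
    rw [hd.circleIntegral_one_div_sub_center_pow_smul hε, Matrix.smul_apply, smul_eq_mul,
      smul_eq_mul]
    have := Complex.two_pi_I_ne_zero
    field_simp
  · intro w' hw' hne
    have hw'' : w' ∈ spectrum ℂ A := by simpa using hw'
    ext i m
    rw [hentry w' hw'']
    refine Finset.sum_eq_zero fun j _ => ?_
    have hd : ∀ z ∈ Metric.closedBall w' ε,
        DifferentiableAt ℂ (fun z => (1 / (z - w) ^ (j + 1)) • f z) z := by
      intro z hz
      have hzw : z - w ≠ 0 := fun h => hne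
        ((hball w' hw'' w (sub_eq_zero.1 h ▸ hz)).2 hw).symm
      refine DifferentiableAt.fun_smul ?_ (hball w' hw'' z hz).1.differentiableAt
      exact (differentiableAt_const _).div (by fun_prop) (pow_ne_zero _ hzw)
    rw [Complex.circleIntegral_eq_zero_of_differentiable_on_off_countable hε.le
      Set.countable_empty (fun z hz => (hd z hz).continuousAt.continuousWithinAt)
      (fun z hz => hd z (Metric.ball_subset_closedBall hz.1))]
    simp
  · intro h
    exact absurd hw (by simpa using h)

/-- A resolution of the identity along the generalized eigenspaces. -/
theorem exists_spectral_resolution (A : Matrix (Fin n) (Fin n) ℂ) :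
    ∃ P : ℂ → Matrix (Fin n) (Fin n) ℂ, ∑ w ∈ A.finite_spectrum.toFinset, P w = 1 ∧
      ∃ k : ℕ, ∀ w ∈ spectrum ℂ A, (A - w • 1) ^ k * P w = 0 := by
  rcases A.finite_spectrum.toFinset.eq_empty_or_nonempty with he | hne
  · rcases Nat.eq_zero_or_pos n with rfl | hn
    · exact ⟨0, Subsingleton.elim _ _, 0, fun w _ => Subsingleton.elim _ _⟩
    · have : NeZero n := ⟨hn.ne'⟩
      obtain ⟨w, hw⟩ := spectrum.nonempty_of_isAlgClosed_of_finiteDimensional ℂ A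
      have : w ∈ A.finite_spectrum.toFinset := by simpa using hw
      simp [he] at this
  let W := A.finite_spectrum.toFinset
  -- The total number of roots bounds every multiplicity, so one exponent serves all eigenvalues.
  let k := A.charpoly.roots.card
  let s : ℂ → Polynomial ℂ := fun w => (Polynomial.X - Polynomial.C w) ^ k
  obtain ⟨q, hq⟩ := (exists_sum_eq_one_iff_pairwise_coprime (s := s) hne).2 (by
    intro x y hxy
    exact ((Polynomial.pairwise_coprime_X_sub_C Subtype.val_injective) hxy).pow)
  have hdvd : A.charpoly ∣ ∏ w ∈ W, s w := by
    rw [(IsAlgClosed.splits A.charpoly).eq_prod_roots, A.charpoly_monic.leadingCoeff,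
      Polynomial.C_1, one_mul, Finset.prod_multiset_map_count]
    have hsub : A.charpoly.roots.toFinset ⊆ W := by
      intro w hw
      simp only [Multiset.mem_toFinset, Polynomial.mem_roots A.charpoly_monic.ne_zero] at hw
      simpa [W] using Matrix.mem_spectrum_iff_isRoot_charpoly.2 hw
    exact (Finset.prod_dvd_prod_of_dvd _ _ fun w _ =>
      pow_dvd_pow _ (Multiset.count_le_card w _)).trans (Finset.prod_dvd_prod_of_subset _ _ _ hsub)
  have hzero : Polynomial.aeval A (∏ w ∈ W, s w) = 0 := by
    obtain ⟨c, hc⟩ := hdvd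
    rw [hc, map_mul, Matrix.aeval_self_charpoly, zero_mul]
  refine ⟨fun w => Polynomial.aeval A (q w * ∏ j ∈ W \ {w}, s j), ?_, k, fun w hw => ?_⟩
  · rw [← map_sum, hq, map_one]
  · have h1 : (A - w • (1 : Matrix (Fin n) (Fin n) ℂ)) ^ k = Polynomial.aeval A (s w) := by
      simp [s, Algebra.algebraMap_eq_smul_one]
    have hwW : w ∈ W := by simpa [W] using hw
    have hprod := Finset.prod_sdiff (f := s) (Finset.singleton_subset_iff.2 hwW)
    rw [Finset.prod_singleton] at hprod
    rw [h1, ← map_mul, mul_left_comm, mul_comm (s w), hprod, map_mul, hzero, mul_zero]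

theorem spectrum_smul_one_add_smul (A : Matrix (Fin n) (Fin n) ℂ) (c t : ℂ) :
    spectrum ℂ (c • (1 : Matrix (Fin n) (Fin n) ℂ) + t • A) =
      (fun w => c + t * w) '' spectrum ℂ A := by
  rcases Nat.eq_zero_or_pos n with rfl | hn
  · simp [spectrum.of_subsingleton]
  have : NeZero n := ⟨hn.ne'⟩
  have h := spectrum.map_polynomial_aeval_of_nonempty A
    (Polynomial.C c + Polynomial.C t * Polynomial.X)
    (spectrum.nonempty_of_isAlgClosed_of_finiteDimensional ℂ A)
  simpa [Algebra.algebraMap_eq_smul_one] using h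

/-- Since `B - (c + t w) 𝟏 = t (A - w 𝟏)` for `B = c 𝟏 + t A`, the resolution for `A` also serves
`B`, even at `t = 0`, where eigenvalues merge. -/
theorem matrixFun_smul_one_add_smul {A : Matrix (Fin n) (Fin n) ℂ}
    {P : ℂ → Matrix (Fin n) (Fin n) ℂ} (hP : ∑ w ∈ A.finite_spectrum.toFinset, P w = 1) {k : ℕ}
    (hk : ∀ w ∈ spectrum ℂ A, (A - w • 1) ^ k * P w = 0) {g : ℂ → ℂ} {c t : ℂ}
    (hg : ∀ w ∈ spectrum ℂ A, AnalyticAt ℂ g (c + t * w)) :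
    matrixFun g (c • (1 : Matrix (Fin n) (Fin n) ℂ) + t • A) =
      ∑ w ∈ A.finite_spectrum.toFinset, ∑ j ∈ Finset.range k,
        (t ^ j * iteratedDeriv j g (c + t * w)) •
          ((j.factorial : ℂ)⁻¹ • ((A - w • 1) ^ j * P w)) := by
  have hg' : AnalyticOnNhd ℂ g (spectrum ℂ (c • (1 : Matrix (Fin n) (Fin n) ℂ) + t • A)) := by
    rw [spectrum_smul_one_add_smul]
    rintro _ ⟨w, hw, rfl⟩
    exact hg w hw
  have hone := congrArg
    (fun Y => matrixFun g (c • (1 : Matrix (Fin n) (Fin n) ℂ) + t • A) * Y) hP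
  simp only [mul_one] at hone
  rw [← hone, Finset.mul_sum]
  refine Finset.sum_congr rfl fun w hw => ?_
  have hw : w ∈ spectrum ℂ A := by simpa using hw
  have hsub : c • (1 : Matrix (Fin n) (Fin n) ℂ) + t • A - (c + t * w) • 1 =
      t • (A - w • 1) := by
    rw [add_smul, smul_sub, smul_smul]
    abel
  rw [matrixFun_mul_eq_sum hg' (w := c + t * w) (k := k)
    (by rw [spectrum_smul_one_add_smul]; exact ⟨w, hw, rfl⟩)
    (by rw [hsub, smul_pow, smul_mul_assoc, hk w hw, smul_zero])]
  refine Finset.sum_congr rfl fun j _ => ?_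
  rw [hsub, smul_pow, smul_mul_assoc, smul_smul, smul_smul]
  congr 1
  ring

theorem matrixFun_eq_sum {A : Matrix (Fin n) (Fin n) ℂ}
    {P : ℂ → Matrix (Fin n) (Fin n) ℂ} (hP : ∑ w ∈ A.finite_spectrum.toFinset, P w = 1) {k : ℕ}
    (hk : ∀ w ∈ spectrum ℂ A, (A - w • 1) ^ k * P w = 0) {g : ℂ → ℂ}
    (hg : AnalyticOnNhd ℂ g (spectrum ℂ A)) :
    matrixFun g A = ∑ w ∈ A.finite_spectrum.toFinset, ∑ j ∈ Finset.range k,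
        iteratedDeriv j g w • ((j.factorial : ℂ)⁻¹ • ((A - w • 1) ^ j * P w)) := by
  simpa using matrixFun_smul_one_add_smul hP hk (c := 0) (t := 1) (g := g)
    (fun w hw => by simpa using hg w hw)

/-! ### Algebraic rules of the functional calculus. -/

theorem matrixFun_congr {A : Matrix (Fin n) (Fin n) ℂ} {f g : ℂ → ℂ}
    (hf : AnalyticOnNhd ℂ f (spectrum ℂ A)) (hfg : ∀ w ∈ spectrum ℂ A, f =ᶠ[𝓝 w] g) :
    matrixFun f A = matrixFun g A := by
  obtain ⟨P, hP, k, hk⟩ := exists_spectral_resolution A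
  rw [matrixFun_eq_sum hP hk hf, matrixFun_eq_sum hP hk fun w hw => (hf w hw).congr (hfg w hw)]
  refine Finset.sum_congr rfl fun w hw => Finset.sum_congr rfl fun j _ => ?_
  rw [(hfg w (by simpa using hw)).iteratedDeriv_eq]

theorem matrixFun_add {A : Matrix (Fin n) (Fin n) ℂ} {f g : ℂ → ℂ}
    (hf : AnalyticOnNhd ℂ f (spectrum ℂ A)) (hg : AnalyticOnNhd ℂ g (spectrum ℂ A)) :
    matrixFun (fun x => f x + g x) A = matrixFun f A + matrixFun g A := by
  obtain ⟨P, hP, k, hk⟩ := exists_spectral_resolution A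
  rw [matrixFun_eq_sum hP hk hf, matrixFun_eq_sum hP hk hg,
    matrixFun_eq_sum (g := fun x => f x + g x) hP hk (hf.add hg)]
  simp only [← Finset.sum_add_distrib]
  refine Finset.sum_congr rfl fun w hw => Finset.sum_congr rfl fun j _ => ?_
  have hw : w ∈ spectrum ℂ A := by simpa using hw
  rw [← add_smul, iteratedDeriv_fun_add (hf w hw).contDiffAt (hg w hw).contDiffAt]

theorem matrixFun_const_mul {A : Matrix (Fin n) (Fin n) ℂ} {f : ℂ → ℂ} (c : ℂ)
    (hf : AnalyticOnNhd ℂ f (spectrum ℂ A)) :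
    matrixFun (fun x => c * f x) A = c • matrixFun f A := by
  obtain ⟨P, hP, k, hk⟩ := exists_spectral_resolution A
  rw [matrixFun_eq_sum hP hk hf, matrixFun_eq_sum (g := fun x => c * f x) hP hk fun w hw =>
    analyticAt_const.mul (hf w hw)]
  simp only [Finset.smul_sum]
  refine Finset.sum_congr rfl fun w hw => Finset.sum_congr rfl fun j _ => ?_
  rw [iteratedDeriv_const_mul_field, mul_smul]

theorem matrixFun_sub {A : Matrix (Fin n) (Fin n) ℂ} {f g : ℂ → ℂ}
    (hf : AnalyticOnNhd ℂ f (spectrum ℂ A)) (hg : AnalyticOnNhd ℂ g (spectrum ℂ A)) :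
    matrixFun (fun x => f x - g x) A = matrixFun f A - matrixFun g A := by
  have h := matrixFun_add hf (g := fun x => -1 * g x) fun w hw => analyticAt_const.mul (hg w hw)
  rw [matrixFun_const_mul _ hg] at h
  simpa [sub_eq_add_neg] using h

theorem matrixFun_id_mul {A : Matrix (Fin n) (Fin n) ℂ} {f : ℂ → ℂ}
    (hf : AnalyticOnNhd ℂ f (spectrum ℂ A)) :
    matrixFun (fun x => x * f x) A = A * matrixFun f A := by
  obtain ⟨P, hP, k, hk⟩ := exists_spectral_resolution A
  have hxf : AnalyticOnNhd ℂ (fun x => x * f x) (spectrum ℂ A) := fun w hw =>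
    analyticAt_id.mul (hf w hw)
  rw [← mul_one (matrixFun _ _), ← mul_one (matrixFun f A), ← hP, Finset.mul_sum, Finset.mul_sum,
    Finset.mul_sum]
  refine Finset.sum_congr rfl fun w hw => ?_
  have hw : w ∈ spectrum ℂ A := by simpa using hw
  -- The factor `x - w` shifts the Taylor coefficients by one, so its expansion is taken one term
  -- longer.
  have hk' : (A - w • 1) ^ (k + 1) * P w = 0 := by rw [pow_succ', mul_assoc, hk w hw, mul_zero]
  set M := A - w • (1 : Matrix (Fin n) (Fin n) ℂ) with hM
  have hsplit : matrixFun (fun x => x * f x) A * P w =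
      matrixFun (fun x => (x - w) * f x) A * P w + w • (matrixFun f A * P w) := by
    have h1 : AnalyticOnNhd ℂ (fun x => (x - w) * f x) (spectrum ℂ A) := fun x hx =>
      (analyticAt_id.sub analyticAt_const).mul (hf x hx)
    have h2 := matrixFun_add h1 (g := fun x => w * f x) fun x hx => analyticAt_const.mul (hf x hx)
    rw [matrixFun_const_mul _ hf] at h2
    rw [← smul_mul_assoc, ← add_mul, ← h2]
    congr 3
    funext x
    ring
  have h1 : AnalyticOnNhd ℂ (fun x => (x - w) * f x) (spectrum ℂ A) := fun x hx =>
    (analyticAt_id.sub analyticAt_const).mul (hf x hx)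
  have hmain : matrixFun (fun x => (x - w) * f x) A * P w = M * (matrixFun f A * P w) := by
    rw [matrixFun_mul_eq_sum h1 hw hk', matrixFun_mul_eq_sum hf hw (hk w hw),
      Finset.sum_range_succ', Finset.mul_sum]
    simp only [iteratedDeriv_zero, sub_self, zero_mul, mul_zero, zero_smul, add_zero]
    refine Finset.sum_congr rfl fun j _ => ?_
    rw [iteratedDeriv_succ_sub_mul w j (hf w hw), mul_smul_comm, ← mul_assoc, ← pow_succ',
      Nat.factorial_succ]
    congr 1
    have : (j.factorial : ℂ) ≠ 0 := by exact_mod_cast j.factorial_ne_zero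
    have : (j + 1 : ℂ) ≠ 0 := by exact_mod_cast j.succ_ne_zero
    push_cast
    field_simp
    ring
  rw [hsplit, hmain]
  have hAY : ∀ Y : Matrix (Fin n) (Fin n) ℂ, A * Y = M * Y + w • Y := fun Y => by
    rw [hM, sub_mul, smul_mul_assoc, one_mul, sub_add_cancel]
  rw [hAY]

theorem matrixFun_eval_mul {A : Matrix (Fin n) (Fin n) ℂ} (p : Polynomial ℂ) {f : ℂ → ℂ}
    (hf : AnalyticOnNhd ℂ f (spectrum ℂ A)) :
    matrixFun (fun x => p.eval x * f x) A = Polynomial.aeval A p * matrixFun f A := by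
  have han : ∀ (p : Polynomial ℂ) {f : ℂ → ℂ}, AnalyticOnNhd ℂ f (spectrum ℂ A) →
      AnalyticOnNhd ℂ (fun x => p.eval x * f x) (spectrum ℂ A) := fun p f hf w hw =>
    (AnalyticOnNhd.eval_polynomial p w (Set.mem_univ w)).mul (hf w hw)
  induction p using Polynomial.induction_on generalizing f with
  | C c =>
    simp only [Polynomial.eval_C, Polynomial.aeval_C, Algebra.algebraMap_eq_smul_one,
      smul_mul_assoc, one_mul]
    exact matrixFun_const_mul c hf
  | add p q hp hq =>
    simp only [Polynomial.eval_add, map_add, add_mul]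
    rw [matrixFun_add (han p hf) (han q hf), hp hf, hq hf]
  | monomial m c ih =>
    have hxf : AnalyticOnNhd ℂ (fun x => x * f x) (spectrum ℂ A) := fun w hw =>
      analyticAt_id.mul (hf w hw)
    rw [pow_succ, ← mul_assoc, map_mul, Polynomial.aeval_X,
      mul_assoc (Polynomial.aeval A _), ← matrixFun_id_mul hf,
      ← ih hxf]
    congr 1
    funext x
    simp only [Polynomial.eval_mul, Polynomial.eval_X]
    ring

theorem isUnit_aeval {A : Matrix (Fin n) (Fin n) ℂ} {v : Polynomial ℂ}
    (hv : ∀ w ∈ spectrum ℂ A, v.eval w ≠ 0) : IsUnit (Polynomial.aeval A v) := by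
  rcases Nat.eq_zero_or_pos n with rfl | hn
  · exact isUnit_of_subsingleton _
  have : NeZero n := ⟨hn.ne'⟩
  rw [← spectrum.zero_notMem_iff ℂ, spectrum.map_polynomial_aeval_of_nonempty A v
    (spectrum.nonempty_of_isAlgClosed_of_finiteDimensional ℂ A)]
  rintro ⟨w, hw, h0⟩
  exact hv w hw h0

/-- The error of interpolation as a function of the matrix. -/
theorem matrixFun_sub_eq {A : Matrix (Fin n) (Fin n) ℂ} {f r h : ℂ → ℂ} {v p : Polynomial ℂ}
    (hf : AnalyticOnNhd ℂ f (spectrum ℂ A)) (hr : AnalyticOnNhd ℂ r (spectrum ℂ A))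
    (hh : AnalyticOnNhd ℂ h (spectrum ℂ A)) (hv : ∀ w ∈ spectrum ℂ A, v.eval w ≠ 0)
    (heq : ∀ w ∈ spectrum ℂ A, ∀ᶠ x in 𝓝 w, v.eval x * (f x - r x) = p.eval x * h x) :
    matrixFun f A - matrixFun r A =
      Polynomial.aeval A p * (Polynomial.aeval A v)⁻¹ * matrixFun h A := by
  have hdet := (Matrix.isUnit_iff_isUnit_det _).1 (isUnit_aeval hv)
  have h1 : Polynomial.aeval A v * (matrixFun f A - matrixFun r A) =
      Polynomial.aeval A p * matrixFun h A := by
    rw [← matrixFun_sub hf hr, ← matrixFun_eval_mul (f := fun x => f x - r x) v (hf.sub hr),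
      ← matrixFun_eval_mul p hh]
    exact matrixFun_congr (fun w hw => (AnalyticOnNhd.eval_polynomial v w (Set.mem_univ w)).mul
      ((hf w hw).sub (hr w hw))) heq
  have hcomm : (Polynomial.aeval A v)⁻¹ * Polynomial.aeval A p =
      Polynomial.aeval A p * (Polynomial.aeval A v)⁻¹ := by
    have h2 : Polynomial.aeval A v * Polynomial.aeval A p =
      Polynomial.aeval A p * Polynomial.aeval A v := by rw [← map_mul, mul_comm, map_mul]
    calc _ = (Polynomial.aeval A v)⁻¹ * (Polynomial.aeval A p * Polynomial.aeval A v) *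
          (Polynomial.aeval A v)⁻¹ := by
          rw [mul_assoc, mul_assoc, Matrix.mul_nonsing_inv _ hdet, mul_one]
      _ = _ := by rw [← h2, ← mul_assoc, Matrix.nonsing_inv_mul _ hdet, one_mul]
  rw [← hcomm, mul_assoc, ← h1, ← mul_assoc, Matrix.nonsing_inv_mul _ hdet, one_mul]

/-! ### Attainment of the maximum and arbitrary norms. -/

variable {N : ℕ}

theorem continuousOn_jetSum {V : Type*} [NormedAddCommGroup V] [NormedSpace ℂ V]
    {W : Finset ℂ} {n : ℕ} {X : ℂ → ℕ → V} {U S : Set ℂ}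
    (hWU : ∀ w ∈ W, ∀ t ∈ Set.Icc (0 : ℝ) 1, ∀ μ ∈ S, (1 - (t : ℂ)) * μ + t * w ∈ U)
    {h : ℂ → ℂ} (hh : AnalyticOnNhd ℂ h U) :
    ContinuousOn (fun p : ℝ × ℂ => jetSum W n X h p.1 p.2) (Set.Icc (0 : ℝ) 1 ×ˢ S) := by
  refine continuousOn_finsetSum _ fun w hw => continuousOn_finsetSum _ fun j _ => ?_
  refine ContinuousOn.fun_smul (ContinuousOn.fun_mul (by fun_prop) fun p hp => ?_)
    continuousOn_const
  have h1 := (analyticAt_iteratedDeriv (hh _ (hWU w hw p.1 hp.1 p.2 hp.2)) j).continuousAt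
  have h2 : ContinuousAt (fun p : ℝ × ℂ => (1 - (p.1 : ℂ)) * p.2 + p.1 * w) p := by fun_prop
  exact (h1.comp_of_eq h2 rfl).continuousWithinAt

theorem jetSum_congr {V : Type*} [AddCommGroup V] [Module ℂ V] {W : Finset ℂ} {n : ℕ}
    {X : ℂ → ℕ → V} {U : Set ℂ} (hU : IsOpen U) {t : ℝ} {μ : ℂ}
    (hWU : ∀ w ∈ W, (1 - (t : ℂ)) * μ + t * w ∈ U) {g h : ℂ → ℂ} (hgh : Set.EqOn g h U) :
    jetSum W n X g t μ = jetSum W n X h t μ := by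
  refine Finset.sum_congr rfl fun w hw => Finset.sum_congr rfl fun j _ => ?_
  rw [(hgh.eventuallyEq_of_mem (hU.mem_nhds (hWU w hw))).iteratedDeriv_eq]

theorem exists_quotient_isGreatest_norm {V : Type*} [NormedAddCommGroup V] [NormedSpace ℂ V]
    (W : Finset ℂ) (n : ℕ) (X : ℂ → ℕ → V) {U S : Set ℂ} (hU : IsOpen U) (hS : Convex ℝ S)
    (hSc : IsCompact S) (hSn : S.Nonempty) (hSU : S ⊆ U)
    (hWU : ∀ w ∈ W, ∀ t ∈ Set.Icc (0 : ℝ) 1, ∀ μ ∈ S, (1 - (t : ℂ)) * μ + t * w ∈ U)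
    (l : List ℂ) (hl : ∀ a ∈ l, a ∈ S) {q : ℂ → ℂ} (hq : AnalyticOnNhd ℂ q U)
    (hord : ∀ a ∈ l, (l.count a : ℕ∞) ≤ analyticOrderAt q a) :
    ∃ h : ℂ → ℂ, AnalyticOnNhd ℂ h U ∧ (∀ x, q x = (l.map fun a => x - a).prod * h x) ∧
      ∃ m : ℝ, IsGreatest {x : ℝ | ∃ t ∈ Set.Icc (0 : ℝ) 1, ∃ μ ∈ S,
        x = ‖(l.length.factorial : ℂ)⁻¹ • jetSum W n X (iteratedDeriv l.length q) t μ‖} m ∧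
        ∀ μ ∈ S, ‖jetSum W n X h 1 μ‖ ≤ m := by
  obtain ⟨h, hh, hprod, hbd⟩ := exists_quotient_with_bound (n := n) (X := X) hU hS hSU hWU l hl
    hq hord
  refine ⟨h, hh, hprod, ?_⟩
  have hqN : AnalyticOnNhd ℂ (iteratedDeriv l.length q) U := fun x hx =>
    analyticAt_iteratedDeriv (hq x hx) _
  have hc : ContinuousOn (fun p : ℝ × ℂ =>
      ‖(l.length.factorial : ℂ)⁻¹ • jetSum W n X (iteratedDeriv l.length q) p.1 p.2‖)
      (Set.Icc (0 : ℝ) 1 ×ˢ S) :=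
    (ContinuousOn.const_smul (continuousOn_jetSum hWU hqN) _).norm
  obtain ⟨⟨t₀, μ₀⟩, ⟨ht₀, hμ₀⟩, hmax⟩ := (isCompact_Icc.prod hSc).exists_isMaxOn
    ((Set.nonempty_Icc.2 zero_le_one).prod hSn) hc
  have hmax' : ∀ t ∈ Set.Icc (0 : ℝ) 1, ∀ μ ∈ S,
      ‖(l.length.factorial : ℂ)⁻¹ • jetSum W n X (iteratedDeriv l.length q) t μ‖ ≤
        ‖(l.length.factorial : ℂ)⁻¹ • jetSum W n X (iteratedDeriv l.length q) t₀ μ₀‖ :=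
    fun t ht μ hμ => isMaxOn_iff.1 hmax (t, μ) ⟨ht, hμ⟩
  refine ⟨_, ⟨⟨t₀, ht₀, μ₀, hμ₀, rfl⟩, ?_⟩, fun μ hμ => ?_⟩
  · rintro _ ⟨t, ht, μ, hμ, rfl⟩
    exact hmax' t ht μ hμ
  · have h0 := hbd 0 ‖(l.length.factorial : ℂ)⁻¹ •
      jetSum W n X (iteratedDeriv l.length q) t₀ μ₀‖ (fun t ht μ hμ => ?_) 1
      (Set.right_mem_Icc.2 zero_le_one) μ hμ
    · rwa [iteratedDeriv_zero, Nat.factorial_zero, Nat.cast_one, one_mul] at h0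
    · have h1 := hmax' t ht μ hμ
      rw [norm_smul, norm_inv, Complex.norm_natCast,
        inv_mul_le_iff₀ (by exact_mod_cast l.length.factorial_pos)] at h1
      rwa [zero_add]

/-- A definite seminorm is a norm; installing it on an abstract `V` allows any norm on matrices
without fixing a global instance. -/
theorem exists_quotient_isGreatest {V : Type*} [AddCommGroup V] [Module ℂ V]
    (ν : Seminorm ℂ V) (hν : ∀ x, ν x = 0 → x = 0)
    (W : Finset ℂ) (n : ℕ) (X : ℂ → ℕ → V) {U S : Set ℂ} (hU : IsOpen U) (hS : Convex ℝ S)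
    (hSc : IsCompact S) (hSn : S.Nonempty) (hSU : S ⊆ U)
    (hWU : ∀ w ∈ W, ∀ t ∈ Set.Icc (0 : ℝ) 1, ∀ μ ∈ S, (1 - (t : ℂ)) * μ + t * w ∈ U)
    (l : List ℂ) (hl : ∀ a ∈ l, a ∈ S) {q : ℂ → ℂ} (hq : AnalyticOnNhd ℂ q U)
    (hord : ∀ a ∈ l, (l.count a : ℕ∞) ≤ analyticOrderAt q a) :
    ∃ h : ℂ → ℂ, AnalyticOnNhd ℂ h U ∧ (∀ x, q x = (l.map fun a => x - a).prod * h x) ∧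
      ∃ m : ℝ, IsGreatest {x : ℝ | ∃ t ∈ Set.Icc (0 : ℝ) 1, ∃ μ ∈ S,
        x = ν ((l.length.factorial : ℂ)⁻¹ • jetSum W n X (iteratedDeriv l.length q) t μ)} m ∧
        ∀ μ ∈ S, ν (jetSum W n X h 1 μ) ≤ m := by
  let : Norm V := ⟨ν⟩
  have core : NormedSpace.Core ℂ V :=
    { norm_nonneg := fun x => apply_nonneg ν x
      norm_smul := fun c x => map_smul_eq_mul ν c x
      norm_triangle := fun x y => map_add_le_add ν x y
      norm_eq_zero_iff := fun x => ⟨hν x, fun h => h ▸ map_zero ν⟩ }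
  let : NormedAddCommGroup V := NormedAddCommGroup.ofCore core
  let : NormedSpace ℂ V := NormedSpace.ofCore core
  exact exists_quotient_isGreatest_norm W n X hU hS hSc hSn hSU hWU l hl hq hord

/-! ### Nodes and the interpolation condition. -/

theorem count_ofFn_eq_nodeMultiplicity (z : Fin N → ℂ) (k : Fin N) :
    (List.ofFn z).count (z k) = nodeMultiplicity z k := by
  classical
  rw [nodeMultiplicity, Nat.card_eq_fintype_card, Fintype.card_subtype, ← Multiset.coe_count,
    ← Fin.univ_val_map, Multiset.count_map]
  simp only [eq_comm (a := z k)]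
  rfl

theorem prod_ofFn_sub_eq_eval_nodePoly (z : Fin N → ℂ) (x : ℂ) :
    ((List.ofFn z).map fun a => x - a).prod = (nodePoly z).eval x := by
  rw [List.map_ofFn, List.prod_ofFn, nodePoly, Polynomial.eval_prod]
  simp

theorem iteratedDeriv_eval_eq_zero {u : Polynomial ℂ} (hu : u.natDegree < N) :
    iteratedDeriv N (fun x => u.eval x) = 0 := by
  have h : ∀ k, iteratedDeriv k (fun x => u.eval x) =
      fun x => (Polynomial.derivative^[k] u).eval x := by
    intro k
    induction k with
    | zero => simp
    | succ k ih =>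
      rw [iteratedDeriv_succ, ih, Function.iterate_succ_apply']
      funext x
      exact Polynomial.deriv (Polynomial.derivative^[k] u)
  rw [h, Polynomial.iterate_derivative_eq_zero hu]
  funext x
  simp

/-- Near the node `v f - u = v (f - r)`, and the order of a product is at least that of the factor
`f - r`. -/
theorem count_le_analyticOrderAt {z : Fin N → ℂ} {f : ℂ → ℂ} {u v : Polynomial ℂ}
    (hr : Interpolates z (fun x => u.eval x / v.eval x) f) (k : Fin N)
    (hf : AnalyticAt ℂ f (z k)) (hv : v.eval (z k) ≠ 0) :
    ((List.ofFn z).count (z k) : ℕ∞) ≤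
      analyticOrderAt (fun x => v.eval x * f x - u.eval x) (z k) := by
  have hva : AnalyticAt ℂ (fun x => v.eval x) (z k) :=
    AnalyticOnNhd.eval_polynomial v (z k) (Set.mem_univ _)
  have hra : AnalyticAt ℂ (fun x => u.eval x / v.eval x) (z k) :=
    (AnalyticOnNhd.eval_polynomial u (z k) (Set.mem_univ _)).div hva hv
  have hev : (fun x => v.eval x * f x - u.eval x) =ᶠ[𝓝 (z k)]
      (fun x => v.eval x) * (fun x => f x - u.eval x / v.eval x) := by
    filter_upwards [hva.continuousAt.eventually_ne hv] with x hx
    simp only [Pi.mul_apply]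
    field_simp
  have hsub : AnalyticAt ℂ (fun x => f x - u.eval x / v.eval x) (z k) := hf.sub hra
  rw [analyticOrderAt_congr hev, analyticOrderAt_mul hva hsub]
  refine le_trans ?_ le_add_self
  rw [natCast_le_analyticOrderAt_iff_iteratedDeriv_eq_zero hsub,
    count_ofFn_eq_nodeMultiplicity]
  intro j hj
  rw [iteratedDeriv_fun_sub hf.contDiffAt hra.contDiffAt, sub_eq_zero]
  exact (hr k j hj).symm

end MatrixEstimate

theorem corollaryc {n N : ℕ} (A : Matrix (Fin n) (Fin n) ℂ) (z : Fin N → ℂ)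
    (U : Set ℂ) (hU : IsOpen U) (hAU : convexHull ℝ (spectrum ℂ A ∪ Set.range z) ⊆ U)
    (f : ℂ → ℂ) (hf : AnalyticOnNhd ℂ f U)
    (u v : Polynomial ℂ) (hu : u.natDegree < N)
    (hvz : ∀ k, v.eval (z k) ≠ 0) (hvA : ∀ w ∈ spectrum ℂ A, v.eval w ≠ 0)
    (hr : MatrixEstimate.Interpolates z (fun x => u.eval x / v.eval x) f)
    -- an arbitrary norm on the space of matrices
    (ν : Seminorm ℂ (Matrix (Fin n) (Fin n) ℂ)) (hν : ∀ M, ν M = 0 → M = 0) :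
    ∃ m : ℝ,
      IsGreatest {x : ℝ | ∃ t ∈ Set.Icc (0 : ℝ) 1, ∃ μ ∈ convexHull ℝ (Set.range z),
        x = ν (MatrixEstimate.remainderMatrix A z v f t μ)} m ∧
      ν (MatrixEstimate.matrixFun f A -
        MatrixEstimate.matrixFun (fun x => u.eval x / v.eval x) A) ≤ m := by
  open MatrixEstimate in
  obtain ⟨P, hP, d, hd⟩ := exists_spectral_resolution A
  set W := A.finite_spectrum.toFinset with hW
  have hWmem : ∀ {w}, w ∈ W ↔ w ∈ spectrum ℂ A := by simp [hW]
  set S := convexHull ℝ (Set.range z) with hS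
  set L := Polynomial.aeval A (nodePoly z) * (Polynomial.aeval A v)⁻¹ with hL
  have hSU : S ⊆ U := (convexHull_mono Set.subset_union_right).trans hAU
  have hσU : spectrum ℂ A ⊆ U := (Set.subset_union_left.trans (subset_convexHull ℝ _)).trans hAU
  have hzS : ∀ k, z k ∈ S := fun k => subset_convexHull ℝ _ ⟨k, rfl⟩
  have hWU : ∀ w ∈ W, ∀ t ∈ Set.Icc (0 : ℝ) 1, ∀ μ ∈ S, (1 - (t : ℂ)) * μ + t * w ∈ U := by
    intro w hw t ht μ hμ
    have h := (convex_convexHull ℝ (spectrum ℂ A ∪ Set.range z))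
      (convexHull_mono Set.subset_union_right hμ)
      (subset_convexHull ℝ _ (Or.inl (hWmem.1 hw))) (sub_nonneg.2 ht.2) ht.1 (sub_add_cancel 1 t)
    simpa using hAU h
  have hev : ∀ (p : Polynomial ℂ) (x : ℂ), AnalyticAt ℂ (fun x => p.eval x) x := fun p x =>
    AnalyticOnNhd.eval_polynomial p x (Set.mem_univ x)
  have hg : AnalyticOnNhd ℂ (fun x => v.eval x * f x) U := fun x hx => (hev v x).mul (hf x hx)
  have hq : AnalyticOnNhd ℂ (fun x => v.eval x * f x - u.eval x) U := fun x hx =>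
    (hg x hx).sub (hev u x)
  -- The factor `L` is absorbed into the coefficients, so the norm is taken of the whole product.
  obtain ⟨h, hh, hprod, m, hm, hle⟩ := exists_quotient_isGreatest ν hν W d
    (fun w j => L * ((j.factorial : ℂ)⁻¹ • ((A - w • 1) ^ j * P w)))
    hU (convex_convexHull ℝ (Set.range z))
    ((Set.finite_range z).isCompact_convexHull (𝕜 := ℝ))
    ⟨z ⟨0, by omega⟩, hzS _⟩ hSU hWU (List.ofFn z) (by simpa [List.mem_ofFn] using hzS) hq (by
      intro a ha
      obtain ⟨k, rfl⟩ := (List.mem_ofFn' z a).1 ha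
      exact count_le_analyticOrderAt hr k (hf _ (hSU (hzS k))) (hvz k))
  rw [List.length_ofFn] at hm
  have hjet : ∀ (g : ℂ → ℂ), AnalyticOnNhd ℂ g U → ∀ t ∈ Set.Icc (0 : ℝ) 1, ∀ μ ∈ S,
      jetSum W d (fun w j => L * ((j.factorial : ℂ)⁻¹ • ((A - w • 1) ^ j * P w))) g t μ =
        L * matrixFun g (((1 - (t : ℂ)) * μ) • (1 : Matrix (Fin n) (Fin n) ℂ) + (t : ℂ) • A) := by
    intro g hg t ht μ hμ
    rw [matrixFun_smul_one_add_smul hP hd fun w hw => hg _ (hWU w (hWmem.2 hw) t ht μ hμ)]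
    simp only [jetSum, Finset.mul_sum, mul_smul_comm, ← hW]
  refine ⟨m, ?_, ?_⟩
  · convert hm using 1
    ext x
    refine exists_congr fun t => and_congr_right fun ht => exists_congr fun μ =>
      and_congr_right fun hμ => ?_
    have hcongr : Set.EqOn (iteratedDeriv N fun x => v.eval x * f x - u.eval x)
        (iteratedDeriv N fun x => v.eval x * f x) U := by
      intro y hy
      rw [iteratedDeriv_fun_sub (hg y hy).contDiffAt (hev u y).contDiffAt,
        iteratedDeriv_eval_eq_zero hu]
      simp
    rw [jetSum_congr hU (fun w hw => hWU w hw t ht μ hμ) hcongr,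
      hjet _ (fun y hy => analyticAt_iteratedDeriv (hg y hy) N) t ht μ hμ, remainderMatrix,
      mul_smul_comm]
  -- At `t = 1` the point `μ` drops out, so any node serves; one exists because `hu` forces `0 < N`.
  · have h1 := hle (z ⟨0, by omega⟩) (hzS _)
    rw [hjet h hh 1 (Set.right_mem_Icc.2 zero_le_one) _ (hzS _)] at h1
    rw [matrixFun_sub_eq (r := fun x => u.eval x / v.eval x) (v := v) (p := nodePoly z) (h := h)
      (fun w hw => hf w (hσU hw))
      (fun w hw => (hev u w).div (hev v w) (hvA w hw)) (fun w hw => hh w (hσU hw)) hvA]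
    · simpa using h1
    · intro w hw
      filter_upwards [(hev v w).continuousAt.eventually_ne (hvA w hw)] with x hx
      rw [← prod_ofFn_sub_eq_eval_nodePoly, ← hprod]
      field_simp
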